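/- Let $H$ be a separable complex Hilbert space, $\alpha\in(0,1)$ and $A\in L(H)$ a bounded linear operator with spectrum $\sigma(A)$. For $\rho>0$ let $$\ell_{2,\rho}=\ell_{2,\rho}(\mathbb Z;H)=\Big\{u\in H^{\mathbb Z}:\ \sum_{k\in\mathbb Z}\|u_k\|^2\rho^{-2k}<\infty\Big\},\qquad \|u\|^2=\sum_{k\in\mathbb Z}\|u_k\|^2\rho^{-2k},$$ let $\tau u=(u_{k+1})_{k\in\mathbb Z}$ be the shift, and let $A$ act on sequences by $(Au)_k=Au_k$. For $\rho>1$ define the bounded operator on $\ell_{2,\rho}$ $$(1-\tau^{-1})^\alpha=\sum_{k=0}^\infty(-1)^k\binom{\alpha}{k}\tau^{-k}.$$ For $x\in H$ and $n\in\mathbb Z$ let $\delta_nx$ be the sequence with value $x$ at $n$ and $0$ elsewhere, and $\chi_{\mathbb Z_{\ge n}}x$ the sequence with value $x$ at every $k\ge n$ and $0$ elsewhere. Consider the linear Riemann--Liouville equation $$\tau(1-\tau^{-1})^\alpha u=Au+\delta_{-1}x\qquad\text{(RL)}$$ and the linear Caputo equation $$\tau(1-\tau^{-1})^\alpha u=Au+(1-\tau^{-1})^\alpha\chi_{\mathbb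 Z_{\ge-1}}x.\qquad\text{(C)}$$ The zero equilibrium of (RL), respectively of (C), is called asymptotically stable if for every $\rho>1$ and every $x\in H$, every solution $u\in\ell_{2,\rho}$ of (RL), respectively of (C), with $u_k=0$ for all $k<0$ satisfies $\lim_{n\to\infty}u_n=0$ in $H$. An operator $B\in L(\ell_{2,\rho})$ is called causal if for every $a\in\mathbb Z$ and every $v\in\ell_{2,\rho}$ with $v_k=0$ for all $k<a$ one has $(Bv)_k=0$ for all $k<a$. Let $f(z)=z(1-z^{-1})^\alpha$ for $|z|>1$ (binomial series, i.e. principal branch), and $S_\mu=\{z\in\mathbb C:|z|=\mu\}$. Suppose that the zero equilibrium of (RL) or the zero equilibrium of (C) is asymptotically stable. Then for every $\mu>1$ the operator $\tau(1-\tau^{-1})^\alpha-A$ is invertible in $L(\ell_{2,\mu})$ with causal inverse, and $\sigma(A)\cap f(S_\mu)=\emptyset$ for every $\mu>1$. Moreover, these two conclusions are equivalent for every $A\in L(H)$, stable or not: $\tau(1-\tau^{-1})^\alpha-A$ is invertible in $L(\ell_{2,\mu})$ with causal inverse for all $\mu>1$ if and only if $\sigma(A)\cap f(S_\mu)=\emptyset$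 for all $\mu>1$. -/

import Mathlib

open scoped ENNReal

noncomputable section

namespace FracDiff

/-! ### Binomial powers -/

/-- `(1 + a) ^ α`, defined for `‖a‖ < 1` in a complex Banach algebra by the binomial series
`∑ₖ (α choose k) aᵏ`. It is used both for complex numbers and for bounded operators. -/
def onePlusPow {𝔸 : Type*} [NormedRing 𝔸] [NormedAlgebra ℂ 𝔸] (α : ℝ) (a : 𝔸) : 𝔸 :=
  (binomialSeries 𝔸 (α : ℂ)).sum a

theorem onePlusPow_eq_tsum {𝔸 : Type*} [NormedRing 𝔸] [NormedAlgebra ℂ 𝔸] (α : ℝ) (a : 𝔸) :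
    onePlusPow α a = ∑' k : ℕ, Ring.choose (α : ℂ) k • a ^ k := by
  simp [onePlusPow, FormalMultilinearSeries.sum]

/-- On complex numbers of modulus less than one this is the principal power. -/
theorem onePlusPow_eq_cpow (α : ℝ) {z : ℂ} (hz : ‖z‖ < 1) :
    onePlusPow α z = (1 + z) ^ (α : ℂ) := by
  have h := (Complex.one_add_cpow_hasFPowerSeriesOnBall_zero (a := (α : ℂ))).sum
    (y := z) (by simpa [enorm_eq_nnnorm, ← NNReal.coe_lt_coe] using hz)
  simpa [onePlusPow] using h.symm

/-- The binomial series converges in norm if `‖a‖ < 1`. -/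
theorem summable_onePlusPow {𝔸 : Type*} [NormedRing 𝔸] [NormedAlgebra ℂ 𝔸] [CompleteSpace 𝔸]
    (α : ℝ) {a : 𝔸} (ha : ‖a‖ < 1) : Summable fun k : ℕ => Ring.choose (α : ℂ) k • a ^ k := by
  have h1 : Summable fun k : ℕ => ‖Ring.choose (α : ℂ) k‖ * ‖a‖ ^ k := by
    have h := (binomialSeries ℂ (α : ℂ)).summable_norm_apply (x := ((‖a‖ : ℝ) : ℂ)) (by
      refine Metric.eball_subset_eball (binomialSeries_radius_ge_one (𝕂 := ℂ)) ?_
      simpa [enorm_eq_nnnorm, ← NNReal.coe_lt_coe] using ha)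
    refine h.congr fun k => ?_
    rw [binomialSeries_apply]
    simp
  refine Summable.of_norm_bounded_eventually_nat h1 ?_
  filter_upwards [Filter.eventually_gt_atTop 0] with k hk
  refine (norm_smul_le _ _).trans ?_
  gcongr
  exact norm_pow_le' a hk

/-! ### The weighted sequence space `ℓ_{2,ρ}(ℤ; H)` -/

section Space

variable (H : Type*) [NormedAddCommGroup H] [InnerProductSpace ℂ H] (ρ : Set.Ioi (0 : ℝ))

theorem memℓp_weight_iff {x : ℤ → H} :
    Memℓp (fun k : ℤ => (((ρ : ℝ) ^ (-k) : ℝ) : ℂ) • x k) 2 ↔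
      Summable fun k : ℤ => ‖x k‖ ^ 2 * (ρ : ℝ) ^ (-2 * k) := by
  have hρ : (0 : ℝ) < ρ := ρ.2
  rw [memℓp_gen_iff (by norm_num)]
  refine summable_congr fun k => ?_
  have : (ρ : ℝ) ^ (-2 * k) = ((ρ : ℝ) ^ (-k)) ^ 2 := by
    rw [← zpow_natCast, ← zpow_mul]; congr 1; push_cast; ring
  rw [this, norm_smul, Complex.norm_real, Real.norm_of_nonneg (zpow_nonneg hρ.le _)]
  norm_num [mul_pow]
  ring

/-- The sequences `x : ℤ → H` with `∑ₖ ‖xₖ‖² ρ^{-2k} < ∞`. -/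
def weightedL2Submodule : Submodule ℂ (ℤ → H) where
  carrier := {x | Summable fun k : ℤ => ‖x k‖ ^ 2 * (ρ : ℝ) ^ (-2 * k)}
  zero_mem' := by simp
  add_mem' := by
    intro x y hx hy
    simp only [Set.mem_ofPred_eq, ← memℓp_weight_iff] at hx hy ⊢
    refine (congrArg (fun g : ℤ → H => Memℓp g 2) (funext fun k => ?_)).mp (hx.add hy)
    simp [smul_add]
  smul_mem' := by
    intro c x hx
    simp only [Set.mem_ofPred_eq, ← memℓp_weight_iff] at hx ⊢
    refine (congrArg (fun g : ℤ → H => Memℓp g 2) (funext fun k => ?_)).mp (hx.const_smul c)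
    exact smul_comm c _ _

/-- The space `ℓ_{2,ρ}(ℤ; H)`. -/
def WeightedL2 : Type _ := weightedL2Submodule H ρ

variable {H ρ}

namespace WeightedL2

instance : AddCommGroup (WeightedL2 H ρ) :=
  inferInstanceAs (AddCommGroup (weightedL2Submodule H ρ))

instance : Module ℂ (WeightedL2 H ρ) :=
  inferInstanceAs (Module ℂ (weightedL2Submodule H ρ))

instance : CoeFun (WeightedL2 H ρ) fun _ => ℤ → H := ⟨fun x => x.1⟩

@[ext] theorem ext {x y : WeightedL2 H ρ} (h : ∀ k, x k = y k) : x = y :=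
  Subtype.ext (funext h)

@[simp] theorem add_apply (x y : WeightedL2 H ρ) (k : ℤ) : (x + y) k = x k + y k := rfl

@[simp] theorem smul_apply (c : ℂ) (x : WeightedL2 H ρ) (k : ℤ) : (c • x) k = c • x k := rfl

/-- The bijection `x ↦ (ρ^{-k} xₖ)ₖ` from `ℓ_{2,ρ}(ℤ; H)` onto the unweighted `ℓ₂(ℤ; H)`. -/
def toLp : WeightedL2 H ρ ≃ₗ[ℂ] lp (fun _ : ℤ => H) 2 where
  toFun x := ⟨fun k => (((ρ : ℝ) ^ (-k) : ℝ) : ℂ) • x k, (memℓp_weight_iff H ρ).2 x.2⟩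
  map_add' x y := by ext k; exact smul_add _ (x k) (y k)
  map_smul' c x := by ext k; exact smul_comm _ c (x k)
  invFun y := ⟨fun k => (((ρ : ℝ) ^ k : ℝ) : ℂ) • y k, (memℓp_weight_iff H ρ).1 (by
    have hρ : (ρ : ℝ) ≠ 0 := ne_of_gt ρ.2
    convert lp.memℓp y using 2 with k
    have h : (((ρ : ℝ) ^ k : ℝ) : ℂ) ≠ 0 := Complex.ofReal_ne_zero.2 (zpow_ne_zero k hρ)
    rw [zpow_neg, Complex.ofReal_inv]
    exact inv_smul_smul₀ h _)⟩
  left_inv x := by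
    have hρ : (ρ : ℝ) ≠ 0 := ne_of_gt ρ.2
    ext k
    have h : (((ρ : ℝ) ^ k : ℝ) : ℂ) ≠ 0 := Complex.ofReal_ne_zero.2 (zpow_ne_zero k hρ)
    change (((ρ : ℝ) ^ k : ℝ) : ℂ) • (((ρ : ℝ) ^ (-k) : ℝ) : ℂ) • x k = x k
    rw [zpow_neg, Complex.ofReal_inv]
    exact smul_inv_smul₀ h _
  right_inv y := by
    have hρ : (ρ : ℝ) ≠ 0 := ne_of_gt ρ.2
    ext k
    have h : (((ρ : ℝ) ^ k : ℝ) : ℂ) ≠ 0 := Complex.ofReal_ne_zero.2 (zpow_ne_zero k hρ)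
    change (((ρ : ℝ) ^ (-k) : ℝ) : ℂ) • (((ρ : ℝ) ^ k : ℝ) : ℂ) • y k = y k
    rw [zpow_neg, Complex.ofReal_inv]
    exact inv_smul_smul₀ h _

/-- The norm of `ℓ_{2,ρ}(ℤ; H)`; see `norm_sq_eq`. -/
instance : NormedAddCommGroup (WeightedL2 H ρ) :=
  NormedAddCommGroup.induced _ _ (toLp : WeightedL2 H ρ ≃ₗ[ℂ] _) toLp.injective

instance : NormedSpace ℂ (WeightedL2 H ρ) :=
  NormedSpace.induced ℂ _ _ (toLp : WeightedL2 H ρ ≃ₗ[ℂ] _)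

theorem norm_toLp (x : WeightedL2 H ρ) : ‖toLp x‖ = ‖x‖ := rfl

theorem norm_sq_eq (x : WeightedL2 H ρ) :
    ‖x‖ ^ 2 = ∑' k : ℤ, ‖x k‖ ^ 2 * (ρ : ℝ) ^ (-2 * k) := by
  have hρ : (0 : ℝ) < ρ := ρ.2
  have h := lp.norm_rpow_eq_tsum (p := 2) (by norm_num) (toLp x)
  rw [norm_toLp] at h
  norm_num at h
  rw [h]
  refine tsum_congr fun k => ?_
  have : (ρ : ℝ) ^ (-2 * k) = ((ρ : ℝ) ^ (-k)) ^ 2 := by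
    rw [← zpow_natCast, ← zpow_mul]; congr 1; push_cast; ring
  rw [this, ← mul_pow, mul_comm]
  change ‖(((ρ : ℝ) ^ (-k) : ℝ) : ℂ) • x k‖ ^ 2 = _
  rw [norm_smul, Complex.norm_real, Real.norm_of_nonneg (zpow_nonneg hρ.le _)]

theorem summable_sq (x : WeightedL2 H ρ) :
    Summable fun k : ℤ => ‖x k‖ ^ 2 * (ρ : ℝ) ^ (-2 * k) := x.2

instance [CompleteSpace H] : CompleteSpace (WeightedL2 H ρ) := by
  let e : WeightedL2 H ρ ≃ₗᵢ[ℂ] lp (fun _ : ℤ => H) 2 := ⟨toLp, norm_toLp⟩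
  exact (completeSpace_congr (e := e.toEquiv) e.isometry.isUniformEmbedding).2 inferInstance

end WeightedL2

end Space

/-! ### Operators on `ℓ_{2,ρ}(ℤ; H)` -/

section Operators

variable {H : Type*} [NormedAddCommGroup H] [InnerProductSpace ℂ H] {ρ : Set.Ioi (0 : ℝ)}

theorem hasSum_shift (m : ℤ) (x : WeightedL2 H ρ) :
    HasSum (fun k : ℤ => ‖x (k + m)‖ ^ 2 * (ρ : ℝ) ^ (-2 * k)) ((ρ : ℝ) ^ (2 * m) * ‖x‖ ^ 2) := by
  have hρ : (ρ : ℝ) ≠ 0 := ne_of_gt ρ.2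
  have h1 : HasSum (fun k : ℤ => ‖x k‖ ^ 2 * (ρ : ℝ) ^ (-2 * k)) (‖x‖ ^ 2) := by
    rw [x.norm_sq_eq]; exact x.summable_sq.hasSum
  have h2 := ((Equiv.addRight m).hasSum_iff.2 h1).mul_left ((ρ : ℝ) ^ (2 * m))
  refine h2.congr_fun fun k => ?_
  simp only [Function.comp, Equiv.coe_addRight]
  rw [mul_left_comm, ← zpow_add₀ hρ]
  congr 2; ring

/-- The shift `(xₖ)ₖ ↦ (x_{k+m})ₖ` on `ℓ_{2,ρ}(ℤ; H)`. -/
def shift (m : ℤ) : WeightedL2 H ρ →L[ℂ] WeightedL2 H ρ :=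
  LinearMap.mkContinuous
    { toFun := fun x => ⟨fun k => x (k + m), (hasSum_shift m x).summable⟩
      map_add' := fun _ _ => rfl
      map_smul' := fun _ _ => rfl } ((ρ : ℝ) ^ m) (by
    intro x
    have hρ : (0 : ℝ) < ρ := ρ.2
    refine le_of_sq_le_sq ?_ (by positivity)
    rw [WeightedL2.norm_sq_eq, mul_pow, ← zpow_natCast ((ρ : ℝ) ^ m), ← zpow_mul, mul_comm m]
    exact (hasSum_shift m x).tsum_eq.le)

@[simp] theorem shift_apply (m : ℤ) (x : WeightedL2 H ρ) (k : ℤ) : shift m x k = x (k + m) := rfl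

/-- The left shift `τ : (xₖ)ₖ ↦ (x_{k+1})ₖ`. -/
def tau : WeightedL2 H ρ →L[ℂ] WeightedL2 H ρ := shift 1

/-- The right shift `τ⁻¹ : (xₖ)ₖ ↦ (x_{k-1})ₖ`. -/
def tauInv : WeightedL2 H ρ →L[ℂ] WeightedL2 H ρ := shift (-1)

theorem tau_mul_tauInv : (tau * tauInv : WeightedL2 H ρ →L[ℂ] WeightedL2 H ρ) = 1 := by
  ext x k; simp [tau, tauInv]

theorem tauInv_mul_tau : (tauInv * tau : WeightedL2 H ρ →L[ℂ] WeightedL2 H ρ) = 1 := by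
  ext x k; simp [tau, tauInv]

theorem norm_tauInv_le : ‖(tauInv : WeightedL2 H ρ →L[ℂ] WeightedL2 H ρ)‖ ≤ (ρ : ℝ)⁻¹ := by
  have hρ : (0 : ℝ) < ρ := ρ.2
  have h : ‖(tauInv : WeightedL2 H ρ →L[ℂ] WeightedL2 H ρ)‖ ≤ (ρ : ℝ) ^ (-1 : ℤ) :=
    ContinuousLinearMap.opNorm_le_bound _ (by positivity) fun x => by
      refine le_of_sq_le_sq ?_ (by positivity)
      rw [WeightedL2.norm_sq_eq, mul_pow, ← zpow_natCast ((ρ : ℝ) ^ (-1 : ℤ)), ← zpow_mul,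
        mul_comm (-1 : ℤ)]
      exact (hasSum_shift (-1) x).tsum_eq.le
  simpa using h

/-- The operator `(1 - τ⁻¹)^α` on `ℓ_{2,ρ}(ℤ; H)`, `ρ > 1`: the binomial series in `-τ⁻¹`,
which converges in operator norm because `‖τ⁻¹‖ = ρ⁻¹ < 1`. -/
def fracDiff (α : ℝ) : WeightedL2 H ρ →L[ℂ] WeightedL2 H ρ :=
  onePlusPow α (-tauInv)

/-- The action of `A ∈ L(H)` on sequences, `(xₖ)ₖ ↦ (A xₖ)ₖ`. -/
def pointwise (A : H →L[ℂ] H) : WeightedL2 H ρ →L[ℂ] WeightedL2 H ρ :=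
  have hρ : (0 : ℝ) < ρ := ρ.2
  have key : ∀ (x : WeightedL2 H ρ) (k : ℤ), ‖A (x k)‖ ^ 2 * (ρ : ℝ) ^ (-2 * k) ≤
      ‖A‖ ^ 2 * (‖x k‖ ^ 2 * (ρ : ℝ) ^ (-2 * k)) := fun x k => by
    rw [← mul_assoc, ← mul_pow]
    gcongr
    exact A.le_opNorm _
  have summ : ∀ x : WeightedL2 H ρ, Summable fun k : ℤ => ‖A (x k)‖ ^ 2 * (ρ : ℝ) ^ (-2 * k) :=
    fun x => Summable.of_nonneg_of_le (fun k => by positivity) (key x) (x.summable_sq.mul_left _)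
  LinearMap.mkContinuous
    { toFun := fun x => ⟨fun k => A (x k), summ x⟩
      map_add' := fun x y => WeightedL2.ext fun k => A.map_add (x k) (y k)
      map_smul' := fun c x => WeightedL2.ext fun k => A.map_smul c (x k) } ‖A‖ (by
    intro x
    refine le_of_sq_le_sq ?_ (by positivity)
    rw [WeightedL2.norm_sq_eq, mul_pow, WeightedL2.norm_sq_eq, ← tsum_mul_left]
    exact (summ x).tsum_le_tsum (key x) (x.summable_sq.mul_left _))

@[simp] theorem pointwise_apply (A : H →L[ℂ] H) (x : WeightedL2 H ρ) (k : ℤ) :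
    pointwise A x k = A (x k) := rfl

/-- The operator `τ (1 - τ⁻¹)^α - A` on `ℓ_{2,ρ}(ℤ; H)`. -/
def eqOperator (α : ℝ) (A : H →L[ℂ] H) : WeightedL2 H ρ →L[ℂ] WeightedL2 H ρ :=
  tau * fracDiff α - pointwise A

/-- `spt x ⊆ ℤ_{≥ a}`. -/
def SupportedGE (a : ℤ) (x : WeightedL2 H ρ) : Prop :=
  Function.support (x : ℤ → H) ⊆ Set.Ici a

/-- Causal operators on `ℓ_{2,ρ}(ℤ; H)`. -/
def Causal (B : WeightedL2 H ρ →L[ℂ] WeightedL2 H ρ) : Prop :=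
  ∀ (a : ℤ) (x : WeightedL2 H ρ), SupportedGE a x → SupportedGE a (B x)

/-- `T` has an inverse in `L(ℓ_{2,ρ}(ℤ; H))`, and this inverse is causal. -/
def InvertibleWithCausalInverse (T : WeightedL2 H ρ →L[ℂ] WeightedL2 H ρ) : Prop :=
  ∃ B : WeightedL2 H ρ →L[ℂ] WeightedL2 H ρ, T * B = 1 ∧ B * T = 1 ∧ Causal B

/-- The sequence `δₙ x`, with value `x` at `n` and `0` elsewhere. -/
def delta (n : ℤ) (x : H) : WeightedL2 H ρ :=
  ⟨Pi.single n x, summable_of_ne_finset_zero (s := {n}) fun k hk => by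
    have : k ≠ n := by simpa using hk
    simp [Pi.single_eq_of_ne this]⟩

/-- The sequence `χ_{ℤ_{≥ n}} x`, with value `x` at `k ≥ n` and `0` elsewhere; it belongs to
`ℓ_{2,ρ}(ℤ; H)` because `ρ > 1`. -/
def stepSeq (hρ : 1 < (ρ : ℝ)) (n : ℤ) (x : H) : WeightedL2 H ρ :=
  ⟨fun k => if n ≤ k then x else 0, by
    have h0 : (0 : ℝ) < ρ := ρ.2
    have hr : ((ρ : ℝ) ^ 2)⁻¹ < 1 := inv_lt_one_of_one_lt₀ (by nlinarith)
    have hg := (summable_geometric_of_lt_one (by positivity) hr).mul_left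
      (‖x‖ ^ 2 * (ρ : ℝ) ^ (-2 * n))
    have hinj : Function.Injective fun j : ℕ => n + (j : ℤ) := fun i j h => by
      simpa using h
    refine (hinj.summable_iff ?_).1 (hg.congr fun j => ?_)
    · intro k hk
      have : ¬ n ≤ k := fun h => hk ⟨(k - n).toNat, by simp [Int.toNat_of_nonneg (sub_nonneg.2 h)]⟩
      simp [this]
    · have hn : n ≤ n + (j : ℤ) := by omega
      simp only [Function.comp, hn, if_true]
      have e : (((ρ : ℝ) ^ 2)⁻¹) ^ j = (ρ : ℝ) ^ (-2 * (j : ℤ)) := by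
        rw [zpow_mul, zpow_natCast]; norm_cast
      rw [e, mul_assoc, ← zpow_add₀ h0.ne', ← mul_add]⟩

end Operators

/-! ### The linear equations and asymptotic stability -/

section Stability

variable {H : Type*} [NormedAddCommGroup H] [InnerProductSpace ℂ H]

/-- `u` solves the Riemann-Liouville equation `τ (1 - τ⁻¹)^α u = A u + δ₋₁ x`. -/
def IsSolutionRL {ρ : Set.Ioi (0 : ℝ)} (α : ℝ) (A : H →L[ℂ] H) (x : H)
    (u : WeightedL2 H ρ) : Prop :=
  tau (fracDiff α u) = pointwise A u + delta (-1) x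

/-- `u` solves the Caputo equation
`τ (1 - τ⁻¹)^α u = A u + (1 - τ⁻¹)^α χ_{ℤ_{≥ -1}} x`. -/
def IsSolutionCaputo {ρ : Set.Ioi (0 : ℝ)} (hρ : 1 < (ρ : ℝ)) (α : ℝ) (A : H →L[ℂ] H) (x : H)
    (u : WeightedL2 H ρ) : Prop :=
  tau (fracDiff α u) = pointwise A u + fracDiff α (stepSeq hρ (-1) x)

/-- Asymptotic stability of the zero equilibrium of the Riemann-Liouville equation. -/
def AsympStableRL (α : ℝ) (A : H →L[ℂ] H) : Prop :=
  ∀ ρ : Set.Ioi (0 : ℝ), 1 < (ρ : ℝ) → ∀ (x : H) (u : WeightedL2 H ρ),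
    IsSolutionRL α A x u → SupportedGE 0 u →
      Filter.Tendsto (fun n : ℤ => u n) Filter.atTop (nhds 0)

/-- Asymptotic stability of the zero equilibrium of the Caputo equation. -/
def AsympStableCaputo (α : ℝ) (A : H →L[ℂ] H) : Prop :=
  ∀ (ρ : Set.Ioi (0 : ℝ)) (hρ : 1 < (ρ : ℝ)) (x : H) (u : WeightedL2 H ρ),
    IsSolutionCaputo hρ α A x u → SupportedGE 0 u →
      Filter.Tendsto (fun n : ℤ => u n) Filter.atTop (nhds 0)

end Stability

/-- The function `f(z) = z (1 - z⁻¹)^α`, for `|z| > 1`. -/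
def symbol (α : ℝ) (z : ℂ) : ℂ := z * onePlusPow α (-z⁻¹)

/-- The circle `S_μ` of radius `μ` around `0`. -/
def circle (μ : ℝ) : Set ℂ := Metric.sphere 0 μ

/-- For `ρ > 1` the series that defines `(1 - τ⁻¹)^α` converges in operator norm, and
`((1 - τ⁻¹)^α u)ₙ = ∑ₖ (-1)ᵏ (α choose k) u_{n-k}`. -/
theorem hasSum_fracDiff {H : Type*} [NormedAddCommGroup H] [InnerProductSpace ℂ H]
    [CompleteSpace H] {ρ : Set.Ioi (0 : ℝ)} (hρ : 1 < (ρ : ℝ)) (α : ℝ) (u : WeightedL2 H ρ)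
    (n : ℤ) :
    HasSum (fun k : ℕ => ((-1) ^ k * Ring.choose (α : ℂ) k) • u (n - k)) (fracDiff α u n) := by
  have hpow : ∀ k : ℕ, ∀ m : ℤ,
      (((-tauInv : WeightedL2 H ρ →L[ℂ] WeightedL2 H ρ) ^ k) u) m = (-1 : ℂ) ^ k • u (m - k) := by
    intro k
    induction k with
    | zero => intro m; simp
    | succ k ih =>
      intro m
      have e : ((-tauInv : WeightedL2 H ρ →L[ℂ] WeightedL2 H ρ) ^ (k + 1)) u =
          (-1 : ℂ) • tauInv (((-tauInv : WeightedL2 H ρ →L[ℂ] WeightedL2 H ρ) ^ k) u) := by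
        rw [pow_succ']; simp
      have hm : m + -1 - (k : ℤ) = m - ((k + 1 : ℕ) : ℤ) := by push_cast; ring
      rw [e, WeightedL2.smul_apply, tauInv, shift_apply, ← tauInv, ih, smul_smul, pow_succ', hm]
  have hnorm : ‖(-tauInv : WeightedL2 H ρ →L[ℂ] WeightedL2 H ρ)‖ < 1 := by
    rw [norm_neg]
    exact norm_tauInv_le.trans_lt (inv_lt_one_of_one_lt₀ hρ)
  have hs := (summable_onePlusPow α hnorm).hasSum
  rw [← onePlusPow_eq_tsum] at hs
  let ev : WeightedL2 H ρ →L[ℂ] H := LinearMap.mkContinuous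
    { toFun := fun x => x n, map_add' := fun _ _ => rfl, map_smul' := fun _ _ => rfl }
    ((ρ : ℝ) ^ n) (by
      intro x
      have h0 : (0 : ℝ) < ρ := ρ.2
      refine le_of_sq_le_sq ?_ (by positivity)
      have h := x.summable_sq.le_tsum n (fun k _ => by positivity)
      rw [← x.norm_sq_eq] at h
      have h2 : (ρ : ℝ) ^ (-2 * n) = (((ρ : ℝ) ^ n) ^ 2)⁻¹ := by
        rw [← zpow_natCast, ← zpow_mul, ← zpow_neg]; congr 1; push_cast; ring
      rw [h2, ← div_eq_mul_inv, div_le_iff₀ (by positivity)] at h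
      rw [mul_pow, mul_comm]
      exact h)
  have h3 := hs.mapL ((ev.comp (ContinuousLinearMap.apply ℂ (WeightedL2 H ρ) u)))
  refine h3.congr_fun fun k => ?_
  change _ = ((Ring.choose (α : ℂ) k • (-tauInv) ^ k : WeightedL2 H ρ →L[ℂ] WeightedL2 H ρ) u) n
  rw [_root_.smul_apply, WeightedL2.smul_apply, hpow, smul_smul, mul_comm]

end FracDiff

end

/-!
Write `f(z) = z (1 - z⁻¹)^α` and `w = z⁻¹`. Invertibility of `f(z) - A` for all `|z| > 1` is the
same as invertibility of the pencil `(1 - w)^α - w A` on the open unit disc, the point `w = 0`,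
where the pencil is `1`, being harmless. All assertions reduce to this condition.

If it holds, the inverse of the pencil is holomorphic on the disc, with Taylor coefficients `Gₙ`,
and `(∑ₙ Gₙ τ⁻ⁿ) τ⁻¹` converges in operator norm for every weight larger than `1`. It is causal,
and it inverts `τ (1 - τ⁻¹)^α - A` because multiplying such series amounts to multiplying Taylor
series (`convOperator_mul`, `sum_antidiagonal_eq_one`, `invertibleWithCausalInverse_of_isUnit`).

Conversely, the transform `û(z) = ∑ₙ z⁻ⁿ uₙ` turns `τ (1 - τ⁻¹)^α u - A u = v` into
`(f(z) - A) û(z) = v̂(z)` wherever `û` converges absolutely (`hasSum_transform_eqOperator`). If this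
equation has, for every `x`, a causal solution for a right-hand side with values in `ℂ x` and
`v̂(z) = S x`, `S ≠ 0`, then `f(z) - A` is onto. It is also injective: for `x` in its kernel the
solution never leaves this kernel, whence `S x = 0` (`symbol_notMem_spectrum`). This applies

* to `u = B δ₀ x` if `B` is a causal inverse, for `|z|` larger than the weight;
* to the solutions of the Riemann-Liouville and of the Caputo equation, if these are stable. They
  exist in `ℓ_{2,ρ}` for some large `ρ` (`exists_invertibleWithCausalInverse`), and since they tend
  to zero they are bounded, so that their transforms converge for all `|z| > 1`.
-/

namespace FracDiff

/-! ### The `z`-transform -/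

section Transform

variable {H : Type*} [NormedAddCommGroup H] [InnerProductSpace ℂ H] {ρ : Set.Ioi (0 : ℝ)}

theorem hasSum_onePlusPow_neg (α : ℝ) {w : ℂ} (hw : ‖w‖ < 1) :
    HasSum (fun k : ℕ => w ^ k * ((-1) ^ k * Ring.choose (α : ℂ) k)) (onePlusPow α (-w)) := by
  have h := (summable_onePlusPow α (a := -w) (by rwa [norm_neg])).hasSum
  rw [← onePlusPow_eq_tsum] at h
  refine h.congr_fun fun k => ?_
  rw [neg_pow, smul_eq_mul]
  ring

theorem norm_inv_lt_one {z : ℂ} (hz : 1 < ‖z‖) : ‖z⁻¹‖ < 1 := by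
  rw [norm_inv]
  exact inv_lt_one_of_one_lt₀ hz

theorem onePlusPow_neg_ne_zero (α : ℝ) {w : ℂ} (hw : ‖w‖ < 1) : onePlusPow α (-w) ≠ 0 := by
  rw [onePlusPow_eq_cpow α (by rwa [norm_neg])]
  have h1 : (1 : ℂ) + -w ≠ 0 := fun h => by
    have : w = 1 := by linear_combination -h
    simp [this] at hw
  simp [Complex.cpow_def_of_ne_zero h1]

/-- The `z`-transform turns the convolution operator `(1 - τ⁻¹)^α` into multiplication by
`(1 - z⁻¹)^α`. Only `|z| > 1` and absolute convergence of the transform of `u` are needed: `|z|`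
may be smaller than the weight `ρ` of the space in which `u` is given. -/
theorem hasSum_transform_fracDiff [CompleteSpace H] (hρ : 1 < (ρ : ℝ)) (α : ℝ)
    (u : WeightedL2 H ρ) {z : ℂ} (hz : 1 < ‖z‖) (hu : Summable fun n : ℤ => ‖z ^ (-n) • u n‖) :
    HasSum (fun n : ℤ => z ^ (-n) • fracDiff α u n)
      (onePlusPow α (-z⁻¹) • ∑' n : ℤ, z ^ (-n) • u n) := by
  have hz0 : z ≠ 0 := norm_pos_iff.1 (zero_lt_one.trans hz)
  have hc := hasSum_onePlusPow_neg α (norm_inv_lt_one hz)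
  have hs : Summable fun p : ℕ × ℤ =>
      ((z⁻¹) ^ p.1 * ((-1) ^ p.1 * Ring.choose (α : ℂ) p.1)) • (z ^ (-p.2) • u p.2) := by
    refine Summable.of_norm ?_
    simp only [norm_smul _ (_ • _)]
    exact (summable_norm_iff.2 hc.summable).mul_of_nonneg hu (fun _ => norm_nonneg _)
      fun _ => norm_nonneg _
  have h := hc.smul hu.of_norm.hasSum hs
  -- the substitution `(n, k) ↦ (k, n - k)` turns the double series into a convolution
  let e : ℤ × ℕ ≃ ℕ × ℤ :=
    { toFun := fun p => (p.2, p.1 - p.2)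
      invFun := fun p => (p.2 + p.1, p.1)
      left_inv := fun p => by simp
      right_inv := fun p => by simp }
  refine (e.hasSum_iff.2 h).prod_fiberwise fun n => ?_
  refine ((hasSum_fracDiff hρ α u n).const_smul (z ^ (-n))).congr_fun fun k => ?_
  simp only [Function.comp, e, Equiv.coe_fn_mk, smul_smul]
  congr 1
  have : z ^ (-(n - (k : ℤ))) = z ^ (-n) * z ^ k := by
    rw [neg_sub, sub_eq_neg_add, zpow_add₀ hz0, zpow_natCast]
  rw [this, inv_pow]
  field_simp

theorem eqOperator_apply (α : ℝ) (A : H →L[ℂ] H) (u : WeightedL2 H ρ) (n : ℤ) :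
    eqOperator α A u n = fracDiff α u (n + 1) - A (u n) := rfl

theorem hasSum_transform_eqOperator [CompleteSpace H] (hρ : 1 < (ρ : ℝ)) (α : ℝ) (A : H →L[ℂ] H)
    (u : WeightedL2 H ρ) {z : ℂ} (hz : 1 < ‖z‖) (hu : Summable fun n : ℤ => ‖z ^ (-n) • u n‖) :
    HasSum (fun n : ℤ => z ^ (-n) • eqOperator α A u n)
      ((algebraMap ℂ (H →L[ℂ] H) (symbol α z) - A) (∑' n : ℤ, z ^ (-n) • u n)) := by
  have hz0 : z ≠ 0 := norm_pos_iff.1 (zero_lt_one.trans hz)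
  have h1 := ((Equiv.addRight (1 : ℤ)).hasSum_iff.2
    (hasSum_transform_fracDiff hρ α u hz hu)).const_smul z
  have h2 := h1.sub (hu.of_norm.hasSum.mapL A)
  have e : (algebraMap ℂ (H →L[ℂ] H) (symbol α z) - A) (∑' n : ℤ, z ^ (-n) • u n) =
      z • onePlusPow α (-z⁻¹) • (∑' n : ℤ, z ^ (-n) • u n) - A (∑' n : ℤ, z ^ (-n) • u n) := by
    rw [Algebra.algebraMap_eq_smul_one, smul_smul, ← symbol]
    rfl
  rw [e]
  refine h2.congr_fun fun n => ?_
  have : z * z ^ (-(n + 1)) = z ^ (-n) := by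
    rw [neg_add, zpow_add₀ hz0]; field_simp
  simp only [Function.comp, Equiv.coe_addRight, smul_smul, this, map_smul, eqOperator_apply,
    smul_sub]

/-- A sequence supported in `ℤ_{≥ a}` that grows at most like `rⁿ` has an absolutely convergent
transform at every `z` with `|z| > r`. -/
theorem summable_transform_of_le {u : ℤ → H} {a : ℤ} {K r : ℝ} {z : ℂ} (hr : 0 < r) (hz : r < ‖z‖)
    (ha : Function.support u ⊆ Set.Ici a) (hK : ∀ n, ‖u n‖ ≤ K * r ^ n) :
    Summable fun n : ℤ => ‖z ^ (-n) • u n‖ := by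
  have hz0 : 0 < ‖z‖ := hr.trans hz
  have hinj : Function.Injective fun j : ℕ => a + (j : ℤ) := fun i j h => by simpa using h
  refine (hinj.summable_iff ?_).1 ?_
  · intro k hk
    have : u k = 0 := by
      by_contra h
      have h' : a ≤ k := ha h
      exact hk ⟨(k - a).toNat, by simp [Int.toNat_of_nonneg (sub_nonneg.2 h')]⟩
    simp [this]
  · refine Summable.of_nonneg_of_le (fun _ => norm_nonneg _) (fun j => ?_)
      ((summable_geometric_of_lt_one (div_nonneg hr.le hz0.le) ((div_lt_one hz0).2 hz)).mul_left
        (K * (r / ‖z‖) ^ a))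
    simp only [Function.comp]
    rw [norm_smul, norm_zpow, mul_assoc, ← zpow_natCast (r / ‖z‖) j,
      ← zpow_add₀ (div_pos hr hz0).ne', div_zpow, zpow_neg]
    have h := mul_le_mul_of_nonneg_left (hK (a + j)) (inv_nonneg.2 (zpow_nonneg hz0.le (a + j)))
    refine h.trans (le_of_eq ?_)
    ring

theorem norm_apply_le (u : WeightedL2 H ρ) (n : ℤ) : ‖u n‖ ≤ ‖u‖ * (ρ : ℝ) ^ n := by
  have h0 : (0 : ℝ) < ρ := ρ.2
  refine le_of_sq_le_sq ?_ (by positivity)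
  have h := u.summable_sq.le_tsum n (fun k _ => by positivity)
  rw [← u.norm_sq_eq] at h
  have h2 : (ρ : ℝ) ^ (-2 * n) = (((ρ : ℝ) ^ n) ^ 2)⁻¹ := by
    rw [← zpow_natCast, ← zpow_mul, ← zpow_neg]; congr 1; push_cast; ring
  rw [h2, ← div_eq_mul_inv, div_le_iff₀ (by positivity)] at h
  rwa [mul_pow]

end Transform

/-! ### Closed subspaces -/

section Invariance

variable {H : Type*} [NormedAddCommGroup H] [InnerProductSpace ℂ H] {ρ : Set.Ioi (0 : ℝ)}

theorem mem_of_hasSum {ι : Type*} {M : Submodule ℂ H} (hM : IsClosed (M : Set H)) {f : ι → H}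
    {s : H} (hf : HasSum f s) (h : ∀ i, f i ∈ M) : s ∈ M :=
  hM.mem_of_tendsto hf (Filter.Eventually.of_forall fun _ => M.sum_mem fun i _ => h i)

theorem fracDiff_apply_mem [CompleteSpace H] (hρ : 1 < (ρ : ℝ)) (α : ℝ) {M : Submodule ℂ H}
    (hM : IsClosed (M : Set H)) {u : WeightedL2 H ρ} (n : ℤ) (h : ∀ k ≤ n, u k ∈ M) :
    fracDiff α u n ∈ M :=
  mem_of_hasSum hM (hasSum_fracDiff hρ α u n) fun k => M.smul_mem _ (h _ (by omega))

/-- A causal sequence `u` stays in a closed `A`-invariant subspace if the right-hand side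
`τ (1 - τ⁻¹)^α u - A u` does: `u n` is determined by its predecessors, as the leading binomial
coefficient is `1`. -/
theorem apply_mem_of_eqOperator_apply_mem [CompleteSpace H] (hρ : 1 < (ρ : ℝ)) (α : ℝ)
    {A : H →L[ℂ] H} {M : Submodule ℂ H} (hM : IsClosed (M : Set H)) (hA : ∀ y ∈ M, A y ∈ M)
    {u : WeightedL2 H ρ} (hu : SupportedGE 0 u) (h : ∀ n, eqOperator α A u n ∈ M) (n : ℤ) :
    u n ∈ M := by
  have key : ∀ m : ℕ, ∀ n : ℤ, n < m → u n ∈ M := by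
    intro m
    induction m with
    | zero =>
      intro n hn
      have : u n = 0 := by
        by_contra h'
        have : (0 : ℤ) ≤ n := hu h'
        simp at hn
        omega
      rw [this]
      exact M.zero_mem
    | succ m ih =>
      intro n hn
      rcases lt_or_ge n m with hlt | hge
      · exact ih n hlt
      have h1 := (hasSum_nat_add_iff' 1).2 (hasSum_fracDiff hρ α u n)
      have h2 := mem_of_hasSum hM h1 fun k => M.smul_mem _ (ih _ (by push_cast at hn ⊢; omega))
      have h3 : fracDiff α u n ∈ M := by
        have := M.add_mem (h (n - 1)) (hA _ (ih (n - 1) (by push_cast at hn; omega)))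
        rwa [eqOperator_apply, sub_add_cancel, sub_add_cancel] at this
      have h4 := M.sub_mem h3 h2
      simpa using h4
  exact key (n + 1).toNat n (by omega)

/-- If for every `x` some causal `u` solves `τ (1 - τ⁻¹)^α u - A u = v` with `v` taking values in
the line through `x` and having transform `S x` at `z`, `S ≠ 0`, and if the transform of `u`
converges absolutely at `z`, then `f(z) - A` is invertible. Transforming the equation gives
surjectivity. If `x` is in the kernel of `f(z) - A` then so are all `u n`, hence the transform of
`u`, so that `S x = 0`. -/
theorem symbol_notMem_spectrum [CompleteSpace H] (α : ℝ) (A : H →L[ℂ] H) {z S : ℂ}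
    (hz : 1 < ‖z‖) (hS : S ≠ 0)
    (h : ∀ x : H, ∃ (ρ : Set.Ioi (0 : ℝ)) (u : WeightedL2 H ρ), 1 < (ρ : ℝ) ∧ SupportedGE 0 u ∧
      (Summable fun n : ℤ => ‖z ^ (-n) • u n‖) ∧ (∀ n, eqOperator α A u n ∈ Submodule.span ℂ {x}) ∧
      HasSum (fun n : ℤ => z ^ (-n) • eqOperator α A u n) (S • x)) :
    symbol α z ∉ spectrum ℂ A := by
  rw [spectrum.notMem_iff, ContinuousLinearMap.isUnit_iff_bijective]
  set T := algebraMap ℂ (H →L[ℂ] H) (symbol α z) - A with hT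
  constructor
  · refine (injective_iff_map_eq_zero T).2 fun x hx => ?_
    obtain ⟨ρ, u, hρ, hu, hs, hspan, hsum⟩ := h x
    have hTA : ∀ y, T y = symbol α z • y - A y := fun y => by
      rw [hT, Algebra.algebraMap_eq_smul_one]; rfl
    have hcl : IsClosed ((T : H →ₗ[ℂ] H).ker : Set H) := T.isClosed_ker
    have hA : ∀ y ∈ (T : H →ₗ[ℂ] H).ker, A y ∈ (T : H →ₗ[ℂ] H).ker := fun y hy => by
      have : A y = symbol α z • y := by
        have hy' : T y = 0 := hy
        rw [hTA, sub_eq_zero] at hy'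
        exact hy'.symm
      rw [this]
      exact Submodule.smul_mem _ _ hy
    have hmem := apply_mem_of_eqOperator_apply_mem hρ α hcl hA hu fun n =>
      (Submodule.span_singleton_le_iff_mem x (T : H →ₗ[ℂ] H).ker).2 hx (hspan n)
    have h0 : T (∑' n : ℤ, z ^ (-n) • u n) = 0 :=
      mem_of_hasSum hcl hs.of_norm.hasSum fun n => Submodule.smul_mem _ _ (hmem n)
    have := (hasSum_transform_eqOperator hρ α A u hz hs).unique hsum
    rw [← hT, h0] at this
    exact (smul_eq_zero.1 this.symm).resolve_left hS
  · intro y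
    obtain ⟨ρ, u, hρ, hu, hs, -, hsum⟩ := h (S⁻¹ • y)
    refine ⟨_, ((hasSum_transform_eqOperator hρ α A u hz hs).unique hsum).trans ?_⟩
    exact smul_inv_smul₀ hS y

end Invariance

/-! ### Power series in the right shift -/

section Causal

variable {H : Type*} [NormedAddCommGroup H] [InnerProductSpace ℂ H] {ρ : Set.Ioi (0 : ℝ)}

/-- The causal convolution operator `∑ₙ Gₙ τ⁻ⁿ` with operator-valued kernel `G`. -/
noncomputable def convOperator (G : ℕ → H →L[ℂ] H) : WeightedL2 H ρ →L[ℂ] WeightedL2 H ρ :=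
  ∑' n, pointwise (G n) * tauInv ^ n

theorem norm_pointwise_le (A : H →L[ℂ] H) :
    ‖(pointwise A : WeightedL2 H ρ →L[ℂ] WeightedL2 H ρ)‖ ≤ ‖A‖ := by
  unfold pointwise
  exact LinearMap.mkContinuous_norm_le _ (norm_nonneg _) _

theorem tauInv_pow_apply (n : ℕ) (u : WeightedL2 H ρ) (k : ℤ) :
    (tauInv ^ n : WeightedL2 H ρ →L[ℂ] WeightedL2 H ρ) u k = u (k - n) := by
  induction n generalizing k with
  | zero => simp
  | succ n ih =>
    have : (tauInv ^ (n + 1) : WeightedL2 H ρ →L[ℂ] WeightedL2 H ρ) u k =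
        (tauInv ^ n : WeightedL2 H ρ →L[ℂ] WeightedL2 H ρ) u (k + -1) := by rw [pow_succ']; rfl
    rw [this, ih, Nat.cast_succ, ← sub_eq_add_neg, sub_sub, add_comm 1]

theorem norm_pointwise_mul_le (A : H →L[ℂ] H) (n : ℕ) :
    ‖(pointwise A * tauInv ^ n : WeightedL2 H ρ →L[ℂ] WeightedL2 H ρ)‖ ≤
      ‖A‖ * ((ρ : ℝ)⁻¹) ^ n := by
  have h0 : (0 : ℝ) < ρ := ρ.2
  rcases Nat.eq_zero_or_pos n with rfl | hn
  · simpa using norm_pointwise_le A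
  refine (norm_mul_le _ _).trans (mul_le_mul (norm_pointwise_le A) ?_ (norm_nonneg _)
    (norm_nonneg _))
  exact (norm_pow_le' _ hn).trans (pow_le_pow_left₀ (norm_nonneg _) norm_tauInv_le n)

theorem summable_norm_convOperator {G : ℕ → H →L[ℂ] H}
    (hG : Summable fun n => ‖G n‖ * ((ρ : ℝ)⁻¹) ^ n) :
    Summable fun n => ‖(pointwise (G n) * tauInv ^ n : WeightedL2 H ρ →L[ℂ] WeightedL2 H ρ)‖ :=
  Summable.of_nonneg_of_le (fun _ => norm_nonneg _) (fun n => norm_pointwise_mul_le _ n) hG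

theorem pointwise_mul_tauInv_pow_apply (A : H →L[ℂ] H) (n : ℕ) (u : WeightedL2 H ρ) (k : ℤ) :
    (pointwise A * tauInv ^ n : WeightedL2 H ρ →L[ℂ] WeightedL2 H ρ) u k = A (u (k - n)) :=
  congrArg A (tauInv_pow_apply n u k)

theorem convOperator_one :
    convOperator (fun n => if n = 0 then 1 else 0) = (1 : WeightedL2 H ρ →L[ℂ] WeightedL2 H ρ) := by
  rw [convOperator, tsum_eq_single 0]
  · ext u k; simp
  · intro n hn
    ext u k
    rw [pointwise_mul_tauInv_pow_apply, if_neg hn]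
    rfl

theorem convOperator_mul [CompleteSpace H] {F G : ℕ → H →L[ℂ] H}
    (hF : Summable fun n => ‖F n‖ * ((ρ : ℝ)⁻¹) ^ n)
    (hG : Summable fun n => ‖G n‖ * ((ρ : ℝ)⁻¹) ^ n) :
    (convOperator F * convOperator G : WeightedL2 H ρ →L[ℂ] WeightedL2 H ρ) =
      convOperator fun n => ∑ p ∈ Finset.HasAntidiagonal.antidiagonal n, F p.1 * G p.2 := by
  rw [convOperator, convOperator, tsum_mul_tsum_eq_tsum_sum_antidiagonal_of_summable_norm
    (summable_norm_convOperator hF) (summable_norm_convOperator hG), convOperator]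
  refine tsum_congr fun n => ?_
  have hsum : (pointwise (∑ p ∈ Finset.HasAntidiagonal.antidiagonal n, F p.1 * G p.2) :
      WeightedL2 H ρ →L[ℂ] WeightedL2 H ρ) =
      ∑ p ∈ Finset.HasAntidiagonal.antidiagonal n, pointwise (F p.1 * G p.2) := by
    let φ : (H →L[ℂ] H) →+ (WeightedL2 H ρ →L[ℂ] WeightedL2 H ρ) :=
      { toFun := pointwise, map_zero' := rfl, map_add' := fun _ _ => rfl }
    exact map_sum φ _ _
  rw [hsum, Finset.sum_mul]
  refine Finset.sum_congr rfl fun p hp => ?_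
  rw [← Finset.HasAntidiagonal.mem_antidiagonal.1 hp]
  ext u k
  refine (pointwise_mul_tauInv_pow_apply (F p.1) p.1 _ k).trans ?_
  refine (congrArg (F p.1) (pointwise_mul_tauInv_pow_apply (G p.2) p.2 u _)).trans ?_
  refine Eq.trans ?_ (pointwise_mul_tauInv_pow_apply (F p.1 * G p.2) (p.1 + p.2) u k).symm
  rw [sub_sub, Nat.cast_add]
  rfl

/-- The evaluation `u ↦ uₙ` as a bounded operator on `ℓ_{2,ρ}(ℤ; H)`. -/
noncomputable def evalCLM (n : ℤ) : WeightedL2 H ρ →L[ℂ] H :=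
  LinearMap.mkContinuous
    { toFun := fun u => u n, map_add' := fun _ _ => rfl, map_smul' := fun _ _ => rfl }
    ((ρ : ℝ) ^ n) fun u => by
      rw [mul_comm]
      exact norm_apply_le u n

theorem hasSum_convOperator_apply [CompleteSpace H] {G : ℕ → H →L[ℂ] H}
    (hG : Summable fun n => ‖G n‖ * ((ρ : ℝ)⁻¹) ^ n) (u : WeightedL2 H ρ) (k : ℤ) :
    HasSum (fun n : ℕ => G n (u (k - n))) (convOperator G u k) := by
  have h := (summable_norm_convOperator hG).of_norm.hasSum.mapL
    ((evalCLM k).comp (ContinuousLinearMap.apply ℂ (WeightedL2 H ρ) u))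
  exact h.congr_fun fun n => (pointwise_mul_tauInv_pow_apply (G n) n u k).symm

theorem causal_convOperator [CompleteSpace H] {G : ℕ → H →L[ℂ] H}
    (hG : Summable fun n => ‖G n‖ * ((ρ : ℝ)⁻¹) ^ n) :
    Causal (convOperator G : WeightedL2 H ρ →L[ℂ] WeightedL2 H ρ) := by
  intro a u hu k hk
  by_contra hka
  refine hk ((hasSum_convOperator_apply hG u k).unique ?_)
  have h0 : ∀ n : ℕ, G n (u (k - n)) = 0 := fun n => by
    have : u (k - n) = 0 := by
      by_contra h'
      have : a ≤ k - n := hu h'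
      exact hka (show a ≤ k by omega)
    rw [this, map_zero]
  simp only [h0]
  exact hasSum_zero

end Causal

/-! ### The inverse operator -/

section Inverse

/-- The coefficients of a product of two power series whose values are inverse to each other near
`0` are those of the constant `1`. -/
theorem sum_antidiagonal_eq_one {𝔸 : Type*} [NormedRing 𝔸] [NormedAlgebra ℂ 𝔸] [CompleteSpace 𝔸]
    {F G : ℕ → 𝔸} {f g : ℂ → 𝔸} {r : ℝ} (hr : 0 < r)
    (hF : ∀ w : ℂ, ‖w‖ < r → Summable fun n => ‖w ^ n • F n‖)
    (hG : ∀ w : ℂ, ‖w‖ < r → Summable fun n => ‖w ^ n • G n‖)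
    (hf : ∀ w : ℂ, ‖w‖ < r → HasSum (fun n => w ^ n • F n) (f w))
    (hg : ∀ w : ℂ, ‖w‖ < r → HasSum (fun n => w ^ n • G n) (g w))
    (hfg : ∀ w : ℂ, ‖w‖ < r → f w * g w = 1) :
    (fun n => ∑ p ∈ Finset.HasAntidiagonal.antidiagonal n, F p.1 * G p.2) = fun n => if n = 0 then 1 else 0 := by
  have series : ∀ a : ℕ → 𝔸, (∀ w : ℂ, ‖w‖ < r → HasSum (fun n => w ^ n • a n) (1 : 𝔸)) →
      HasFPowerSeriesAt (fun _ : ℂ => (1 : 𝔸))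
        (fun n => ContinuousMultilinearMap.mkPiRing ℂ (Fin n) (a n)) 0 := by
    intro a ha
    refine hasFPowerSeriesAt_iff.2 ?_
    filter_upwards [Metric.ball_mem_nhds (0 : ℂ) hr] with w hw
    refine (ha w (by simpa using hw)).congr_fun fun n => ?_
    simp [FormalMultilinearSeries.coeff]
  have h1 := series (fun n => ∑ p ∈ Finset.HasAntidiagonal.antidiagonal n, F p.1 * G p.2) fun w hw => by
    have e : ∀ n, ∑ p ∈ Finset.HasAntidiagonal.antidiagonal n, (w ^ p.1 • F p.1) * (w ^ p.2 • G p.2) =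
        w ^ n • ∑ p ∈ Finset.HasAntidiagonal.antidiagonal n, F p.1 * G p.2 := fun n => by
      rw [Finset.smul_sum]
      refine Finset.sum_congr rfl fun p hp => ?_
      rw [smul_mul_smul_comm, ← pow_add, Finset.HasAntidiagonal.mem_antidiagonal.1 hp]
    have hs := (summable_norm_sum_mul_antidiagonal_of_summable_norm (hF w hw) (hG w hw)).of_norm
    have ht := tsum_mul_tsum_eq_tsum_sum_antidiagonal_of_summable_norm (hF w hw) (hG w hw)
    rw [(hf w hw).tsum_eq, (hg w hw).tsum_eq, hfg w hw] at ht
    have := hs.hasSum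
    rw [← ht] at this
    exact this.congr_fun fun n => (e n).symm
  have h2 := series (fun n => if n = 0 then 1 else 0) fun w hw => by
    convert hasSum_single (f := fun n => w ^ n • (if n = 0 then (1 : 𝔸) else 0)) 0 ?_ using 1
    · simp
    · intro n hn
      simp [hn]
  have h := h1.eq_formalMultilinearSeries h2
  funext n
  have := congrArg (fun p => FormalMultilinearSeries.coeff p n) h
  simpa [FormalMultilinearSeries.coeff] using this

variable {H : Type*} [NormedAddCommGroup H] [InnerProductSpace ℂ H] {ρ : Set.Ioi (0 : ℝ)}

/-- The Taylor coefficients at `0` of the operator pencil `w ↦ (1 - w)^α - w A`. -/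
noncomputable def pencilCoeff (α : ℝ) (A : H →L[ℂ] H) (n : ℕ) : H →L[ℂ] H :=
  ((-1) ^ n * Ring.choose (α : ℂ) n) • 1 - if n = 1 then A else 0

theorem summable_norm_pencilCoeff (α : ℝ) (A : H →L[ℂ] H) {r : ℝ} (h0 : 0 ≤ r) (h1 : r < 1) :
    Summable fun n => ‖pencilCoeff α A n‖ * r ^ n := by
  have hc := summable_norm_iff.2 (hasSum_onePlusPow_neg α (w := (r : ℂ))
    (by rwa [Complex.norm_real, Real.norm_of_nonneg h0])).summable
  have hA : Summable fun n : ℕ => ‖(if n = 1 then A else 0 : H →L[ℂ] H)‖ * r ^ n :=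
    summable_of_ne_finset_zero (s := {1}) fun n hn => by
      simp only [Finset.mem_singleton] at hn
      simp [hn]
  refine Summable.of_nonneg_of_le (fun n => by positivity) (fun n => ?_)
    ((hc.mul_right ‖(1 : H →L[ℂ] H)‖).add hA)
  have h : ‖pencilCoeff α A n‖ ≤ ‖(-1) ^ n * Ring.choose (α : ℂ) n‖ * ‖(1 : H →L[ℂ] H)‖ +
      ‖(if n = 1 then A else 0 : H →L[ℂ] H)‖ := by
    rw [← norm_smul]
    exact norm_sub_le _ _
  refine (mul_le_mul_of_nonneg_right h (pow_nonneg h0 n)).trans (le_of_eq ?_)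
  rw [norm_mul ((r : ℂ) ^ n), norm_pow, Complex.norm_real, Real.norm_of_nonneg h0]
  ring

theorem hasSum_pencilCoeff (α : ℝ) (A : H →L[ℂ] H) {w : ℂ} (hw : ‖w‖ < 1) :
    HasSum (fun n => w ^ n • pencilCoeff α A n)
      (onePlusPow α (-w) • (1 : H →L[ℂ] H) - w • A) := by
  have hA := hasSum_single (f := fun n : ℕ => w ^ n • (if n = 1 then A else 0 : H →L[ℂ] H)) 1
    fun n hn => by simp [hn]
  simp only [if_true, pow_one] at hA
  refine (((hasSum_onePlusPow_neg α hw).smul_const (1 : H →L[ℂ] H)).sub hA).congr_fun fun n => ?_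
  rw [pencilCoeff, smul_sub, smul_smul]

theorem tau_mul_convOperator_pencilCoeff [CompleteSpace H] (hρ : 1 < (ρ : ℝ)) (α : ℝ)
    (A : H →L[ℂ] H) :
    tau * convOperator (pencilCoeff α A) =
      (eqOperator α A : WeightedL2 H ρ →L[ℂ] WeightedL2 H ρ) := by
  have h0 : (0 : ℝ) < ρ := ρ.2
  ext u k
  have h := hasSum_convOperator_apply
    (summable_norm_pencilCoeff α A (inv_nonneg.2 h0.le) (inv_lt_one_of_one_lt₀ hρ)) u (k + 1)
  have hA := hasSum_single (f := fun n : ℕ => (if n = 1 then A else 0 : H →L[ℂ] H)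
    (u (k + 1 - n))) 1 fun n hn => by simp [hn]
  simp only [if_true, Nat.cast_one, add_sub_cancel_right] at hA
  refine (h.unique (((hasSum_fracDiff hρ α u (k + 1)).sub hA).congr_fun fun n => ?_))
  rfl

theorem differentiableAt_onePlusPow_neg (α : ℝ) {w : ℂ} (hw : ‖w‖ < 1) :
    DifferentiableAt ℂ (fun w => onePlusPow α (-w)) w := by
  have h : DifferentiableAt ℂ (fun w : ℂ => (1 + -w) ^ (α : ℂ)) w := by
    refine DifferentiableAt.cpow_const (by fun_prop) ?_
    exact Complex.mem_slitPlane_of_norm_lt_one (by rwa [norm_neg])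
  refine h.congr_of_eventuallyEq ?_
  filter_upwards [Metric.isOpen_ball.mem_nhds (mem_ball_zero_iff.2 hw)] with v hv
  exact onePlusPow_eq_cpow α (by rw [norm_neg]; exact mem_ball_zero_iff.1 hv)

/-- If the pencil `(1 - w)^α - w A` is invertible for `|w| < R`, its inverse is holomorphic there,
and inserting `τ⁻¹` for `w` in the Taylor series gives the inverse of `τ⁻¹ (τ (1 - τ⁻¹)^α - A)` as
a norm convergent series of causal operators, for weights larger than `R⁻¹`. -/
theorem invertibleWithCausalInverse_of_isUnit [CompleteSpace H] (α : ℝ) (A : H →L[ℂ] H) {R : ℝ}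
    (hR1 : R ≤ 1)
    (hunit : ∀ w : ℂ, ‖w‖ < R → IsUnit (onePlusPow α (-w) • (1 : H →L[ℂ] H) - w • A))
    (hρ : (ρ : ℝ)⁻¹ < R) :
    InvertibleWithCausalInverse
      (eqOperator α A : WeightedL2 H ρ →L[ℂ] WeightedL2 H ρ) := by
  have h0 : (0 : ℝ) < ρ := ρ.2
  have hi : (0 : ℝ) < (ρ : ℝ)⁻¹ := inv_pos.2 h0
  have hρ1 : 1 < (ρ : ℝ) := (inv_lt_one₀ h0).1 (hρ.trans_le hR1)
  obtain ⟨r, hr, hrR⟩ := exists_between hρ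
  have hr0 : 0 < r := hi.trans hr
  lift r to NNReal using hr0.le
  set P : ℂ → H →L[ℂ] H := fun w => onePlusPow α (-w) • (1 : H →L[ℂ] H) - w • A with hP
  have hdiff : DifferentiableOn ℂ (fun w => Ring.inverse (P w)) (Metric.closedBall 0 (r : ℝ)) := by
    intro w hw
    have hw' : ‖w‖ < R := (mem_closedBall_zero_iff.1 hw).trans_lt hrR
    have hPw : DifferentiableAt ℂ P w :=
      ((differentiableAt_onePlusPow_neg α (hw'.trans_le hR1)).smul_const _).sub
        (differentiableAt_fun_id.smul_const A)
    exact (hPw.inverse (hunit w hw')).differentiableWithinAt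
  have hp := hdiff.hasFPowerSeriesOnBall (by exact_mod_cast hr0)
  set p := cauchyPowerSeries (fun w => Ring.inverse (P w)) 0 r
  have hsub : ∀ s : NNReal, (s : ℝ) < r → Summable fun n => ‖p.coeff n‖ * (s : ℝ) ^ n :=
    fun s hs => by
      have := p.summable_norm_mul_pow (r := s)
        (lt_of_lt_of_le (by exact_mod_cast hs) hp.r_le)
      simpa only [FormalMultilinearSeries.norm_apply_eq_norm_coef] using this
  have hGs : ∀ w : ℂ, ‖w‖ < r → Summable fun n => ‖w ^ n • p.coeff n‖ := fun w hw =>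
    (hsub ‖w‖₊ hw).congr fun n => by
      rw [norm_smul, norm_pow, coe_nnnorm, mul_comm]
  have hG : ∀ w : ℂ, ‖w‖ < r → HasSum (fun n => w ^ n • p.coeff n) (Ring.inverse (P w)) :=
    fun w hw => by
      have := hp.hasSum (y := w) (by
        rw [Metric.mem_eball, edist_zero_right, enorm_eq_nnnorm]; exact_mod_cast hw)
      simpa only [FormalMultilinearSeries.apply_eq_pow_smul_coeff, zero_add] using this
  have hr1 : ∀ w : ℂ, ‖w‖ < r → ‖w‖ < 1 := fun w hw => (hw.trans hrR).trans_le hR1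
  have hF : ∀ w : ℂ, ‖w‖ < r → HasSum (fun n => w ^ n • pencilCoeff α A n) (P w) :=
    fun w hw => hasSum_pencilCoeff α A (hr1 w hw)
  have hFs : ∀ w : ℂ, ‖w‖ < r → Summable fun n => ‖w ^ n • pencilCoeff α A n‖ := fun w hw =>
    (summable_norm_pencilCoeff α A (norm_nonneg w) (hr1 w hw)).congr fun n => by
      rw [norm_smul, norm_pow, mul_comm]
  have hFG := sum_antidiagonal_eq_one hr0 hFs hGs hF hG fun w hw =>
    Ring.mul_inverse_cancel _ (hunit w (hw.trans hrR))
  have hGF := sum_antidiagonal_eq_one hr0 hGs hFs hG hF fun w hw =>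
    Ring.inverse_mul_cancel _ (hunit w (hw.trans hrR))
  have hsF := summable_norm_pencilCoeff α A hi.le (inv_lt_one_of_one_lt₀ hρ1)
  have hsG : Summable fun n => ‖p.coeff n‖ * ((ρ : ℝ)⁻¹) ^ n := hsub ⟨(ρ : ℝ)⁻¹, hi.le⟩ hr
  have hTB := convOperator_mul hsF hsG
  have hBT := convOperator_mul hsG hsF
  rw [hFG, convOperator_one] at hTB
  rw [hGF, convOperator_one] at hBT
  rw [← tau_mul_convOperator_pencilCoeff hρ1]
  refine ⟨convOperator (fun n => p.coeff n) * tauInv, ?_, ?_, ?_⟩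
  · rw [mul_assoc, ← mul_assoc (convOperator _), hTB, one_mul, tau_mul_tauInv]
  · rw [mul_assoc, ← mul_assoc tauInv, tauInv_mul_tau, one_mul, hBT]
  · intro a u hu
    refine causal_convOperator hsG a (tauInv u) fun k hk => ?_
    have : a ≤ k + -1 := hu hk
    exact show a ≤ k by omega

end Inverse

/-! ### Spectrum, invertibility and stability -/

section Stability

variable {H : Type*} [NormedAddCommGroup H] [InnerProductSpace ℂ H] {ρ : Set.Ioi (0 : ℝ)}

theorem onePlusPow_zero (α : ℝ) : onePlusPow α (0 : ℂ) = 1 := by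
  rw [onePlusPow_eq_cpow α (by simp)]
  simp

theorem isUnit_pencil_of_notMem_spectrum {α : ℝ} {A : H →L[ℂ] H}
    (h : ∀ z : ℂ, 1 < ‖z‖ → symbol α z ∉ spectrum ℂ A) {w : ℂ} (hw : ‖w‖ < 1) :
    IsUnit (onePlusPow α (-w) • (1 : H →L[ℂ] H) - w • A) := by
  rcases eq_or_ne w 0 with rfl | hw0
  · simp [onePlusPow_zero]
  · have hz : 1 < ‖w⁻¹‖ := by
      rw [norm_inv]
      exact (one_lt_inv₀ (norm_pos_iff.2 hw0)).2 hw
    have h1 := spectrum.notMem_iff.1 (h _ hz)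
    have e : onePlusPow α (-w) • (1 : H →L[ℂ] H) - w • A =
        Units.mk0 w hw0 • (algebraMap ℂ (H →L[ℂ] H) (symbol α w⁻¹) - A) := by
      rw [Units.smul_mk0, Algebra.algebraMap_eq_smul_one, smul_sub, smul_smul, symbol, inv_inv,
        mul_inv_cancel_left₀ hw0]
    rw [e]
    exact (isUnit_smul_iff _ _).2 h1

/-- For large weights `τ (1 - τ⁻¹)^α - A` is invertible whatever `A`: the pencil is `1` at `0`,
and the units form an open set. This provides the solutions of the initial value problems. -/
theorem exists_invertibleWithCausalInverse [CompleteSpace H] (α : ℝ) (A : H →L[ℂ] H) :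
    ∃ ρ : Set.Ioi (0 : ℝ), 1 < (ρ : ℝ) ∧
      InvertibleWithCausalInverse (eqOperator α A : WeightedL2 H ρ →L[ℂ] WeightedL2 H ρ) := by
  have hc : ContinuousAt (fun w : ℂ => onePlusPow α (-w) • (1 : H →L[ℂ] H) - w • A) 0 :=
    ((differentiableAt_onePlusPow_neg α (by simp)).continuousAt.smul continuousAt_const).sub
      (continuousAt_id.smul continuousAt_const)
  have hu : {x : H →L[ℂ] H | IsUnit x} ∈
      nhds (onePlusPow α (-0 : ℂ) • (1 : H →L[ℂ] H) - (0 : ℂ) • A) := by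
    refine Units.isOpen.mem_nhds ?_
    simp [onePlusPow_zero]
  obtain ⟨ε, hε, hball⟩ := Metric.mem_nhds_iff.1 (hc.preimage_mem_nhds hu)
  have hR : 0 < min ε 1 := lt_min hε one_pos
  refine ⟨⟨2 * (min ε 1)⁻¹, by simpa using hR⟩, ?_, ?_⟩
  · have : 1 ≤ (min ε 1)⁻¹ := (one_le_inv₀ hR).2 (min_le_right _ _)
    simp only
    linarith
  · refine invertibleWithCausalInverse_of_isUnit α A (min_le_right ε 1) (fun w hw => ?_) ?_
    · exact hball (mem_ball_zero_iff.2 (hw.trans_le (min_le_left _ _)))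
    · simp only [mul_inv, inv_inv]
      linarith

theorem eqOperator_eq_iff {α : ℝ} {A : H →L[ℂ] H} {u v : WeightedL2 H ρ} :
    eqOperator α A u = v ↔ tau (fracDiff α u) = pointwise A u + v := by
  change tau (fracDiff α u) - pointwise A u = v ↔ _
  rw [sub_eq_iff_eq_add']

theorem delta_apply (n k : ℤ) (x : H) :
    (delta n x : WeightedL2 H ρ) k = if k = n then x else 0 :=
  Pi.single_apply n x k

theorem supportedGE_delta (n : ℤ) (x : H) : SupportedGE n (delta n x : WeightedL2 H ρ) :=
  fun k hk => by
    by_contra hkn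
    refine hk ((delta_apply n k x).trans (if_neg ?_))
    rintro rfl
    exact hkn Set.self_mem_Ici

/-- A causal solution is supported in `ℤ_{≥ 0}` if the right-hand side is supported in
`ℤ_{≥ -1}`: at `-2` the equation reads `u₋₁ = 0`. -/
theorem supportedGE_zero_of_eqOperator [CompleteSpace H] (hρ : 1 < (ρ : ℝ)) {α : ℝ}
    {A : H →L[ℂ] H} {B : WeightedL2 H ρ →L[ℂ] WeightedL2 H ρ} (hB : Causal B)
    (hTB : eqOperator α A * B = 1) {v : WeightedL2 H ρ} (hv : SupportedGE (-1) v) :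
    SupportedGE 0 (B v) := by
  have hu := hB (-1) v hv
  have hneg : ∀ k : ℤ, k < -1 → B v k = 0 := fun k hk => by
    by_contra h
    have : -1 ≤ k := hu h
    omega
  have hTu : eqOperator α A (B v) = v := congrArg (fun T => T v) hTB
  have hm1 : B v (-1) = 0 := by
    have h1 : eqOperator α A (B v) (-2) = 0 := by
      rw [hTu]
      by_contra h
      have : (-1 : ℤ) ≤ -2 := hv h
      omega
    have h2 := hasSum_single (f := fun k : ℕ =>
      ((-1) ^ k * Ring.choose (α : ℂ) k) • B v (-1 - (k : ℤ))) 0 fun k hk =>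
        (congrArg _ (hneg _ (by omega))).trans (smul_zero _)
    have h3 := h2.unique (hasSum_fracDiff hρ α (B v) (-1))
    rw [eqOperator_apply, hneg (-2) (by omega), map_zero, sub_zero] at h1
    simpa using h3.trans h1
  intro k hk
  by_contra h
  have hk0 : k < 0 := not_le.1 h
  rcases (show k < -1 ∨ k = -1 by omega) with h' | rfl
  · exact hk (hneg k h')
  · exact hk hm1

/-- Solutions supported in `ℤ_{≥ 0}` that tend to `0` are bounded, so their transforms converge
for all `|z| > 1`. -/
theorem summable_transform_of_tendsto_zero {u : ℤ → H} (hu : Function.support u ⊆ Set.Ici 0)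
    (h : Filter.Tendsto u Filter.atTop (nhds 0)) {z : ℂ} (hz : 1 < ‖z‖) :
    Summable fun n : ℤ => ‖z ^ (-n) • u n‖ := by
  have h1 := ((h.comp tendsto_natCast_atTop_atTop).norm).bddAbove_range
  obtain ⟨K, hK⟩ := h1
  refine summable_transform_of_le (K := max K 0) one_pos hz hu fun n => ?_
  rw [one_zpow, mul_one]
  rcases lt_or_ge n 0 with hn | hn
  · have : u n = 0 := by
      by_contra h'
      have : (0 : ℤ) ≤ n := hu h'
      omega
    rw [this, norm_zero]
    exact le_max_right _ _
  · lift n to ℕ using hn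
    exact (hK ⟨n, rfl⟩).trans (le_max_left _ _)

theorem hasSum_transform_delta (n : ℤ) (x : H) (z : ℂ) :
    HasSum (fun k : ℤ => z ^ (-k) • (delta n x : WeightedL2 H ρ) k) (z ^ (-n) • x) := by
  have h := hasSum_single (f := fun k : ℤ => z ^ (-k) • (delta n x : WeightedL2 H ρ) k) n
    fun k hk => by rw [delta_apply, if_neg hk, smul_zero]
  rwa [delta_apply, if_pos rfl] at h

theorem delta_apply_mem_span (n k : ℤ) (x : H) :
    (delta n x : WeightedL2 H ρ) k ∈ Submodule.span ℂ {x} := by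
  rw [delta_apply]
  split_ifs
  · exact Submodule.mem_span_singleton_self x
  · exact Submodule.zero_mem _

theorem stepSeq_apply (hρ : 1 < (ρ : ℝ)) (n k : ℤ) (x : H) :
    stepSeq hρ n x k = if n ≤ k then x else 0 := rfl

/-- The transform of the step sequence `χ_{ℤ_{≥ -1}} x` is a nonzero multiple of `x`, namely
`z² / (z - 1)` times `x`. -/
theorem hasSum_transform_stepSeq (hρ : 1 < (ρ : ℝ)) (x : H) {z : ℂ} (hz : 1 < ‖z‖) :
    HasSum (fun k : ℤ => z ^ (-k) • stepSeq hρ (-1) x k) ((z * (1 - z⁻¹)⁻¹) • x) := by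
  have hz0 : z ≠ 0 := norm_pos_iff.1 (zero_lt_one.trans hz)
  have hinj : Function.Injective fun j : ℕ => -1 + (j : ℤ) := fun i j h => by simpa using h
  refine (hinj.hasSum_iff ?_).1 ?_
  · intro k hk
    have : ¬ -1 ≤ k := fun h => hk ⟨(k + 1).toNat, by
      simp only
      omega⟩
    rw [stepSeq_apply, if_neg this, smul_zero]
  · refine (((hasSum_geometric_of_norm_lt_one (norm_inv_lt_one hz)).mul_left z).smul_const
      x).congr_fun fun j => ?_
    simp only [Function.comp]
    rw [stepSeq_apply, if_pos (by omega), neg_add, neg_neg, zpow_add₀ hz0, zpow_one, zpow_neg,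
      zpow_natCast, inv_pow]

theorem notMem_spectrum_of_invertible [CompleteSpace H] (hρ : 1 < (ρ : ℝ)) {α : ℝ} {A : H →L[ℂ] H}
    (h : InvertibleWithCausalInverse (eqOperator α A : WeightedL2 H ρ →L[ℂ] WeightedL2 H ρ))
    {z : ℂ} (hz : (ρ : ℝ) < ‖z‖) : symbol α z ∉ spectrum ℂ A := by
  obtain ⟨B, hTB, -, hB⟩ := h
  refine symbol_notMem_spectrum α A (hρ.trans hz) one_ne_zero fun x => ?_
  have hTu : eqOperator α A (B (delta 0 x)) = delta 0 x := congrArg (fun T => T (delta 0 x)) hTB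
  have hsupp : SupportedGE 0 (B (delta 0 x)) := hB 0 _ (supportedGE_delta 0 x)
  refine ⟨ρ, B (delta 0 x), hρ, hsupp, ?_, ?_, ?_⟩
  · exact summable_transform_of_le ρ.2 hz hsupp (norm_apply_le _)
  · intro n
    rw [hTu]
    exact delta_apply_mem_span 0 n x
  · rw [hTu]
    simpa using hasSum_transform_delta (ρ := ρ) 0 x z

theorem notMem_spectrum_of_asympStableRL [CompleteSpace H] {α : ℝ} {A : H →L[ℂ] H}
    (h : AsympStableRL α A) {z : ℂ} (hz : 1 < ‖z‖) : symbol α z ∉ spectrum ℂ A := by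
  obtain ⟨ρ, hρ, B, hTB, -, hB⟩ := exists_invertibleWithCausalInverse α A
  have hz0 : z ≠ 0 := norm_pos_iff.1 (zero_lt_one.trans hz)
  refine symbol_notMem_spectrum α A hz hz0 fun x => ?_
  have hTu : eqOperator α A (B (delta (-1) x)) = delta (-1) x :=
    congrArg (fun T => T (delta (-1) x)) hTB
  have hsupp : SupportedGE 0 (B (delta (-1) x)) :=
    supportedGE_zero_of_eqOperator hρ hB hTB (supportedGE_delta (-1) x)
  refine ⟨ρ, B (delta (-1) x), hρ, hsupp, ?_, ?_, ?_⟩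
  · exact summable_transform_of_tendsto_zero hsupp
      (h ρ hρ x _ (eqOperator_eq_iff.1 hTu) hsupp) hz
  · intro n
    rw [hTu]
    exact delta_apply_mem_span (-1) n x
  · rw [hTu]
    simpa using hasSum_transform_delta (ρ := ρ) (-1) x z

theorem notMem_spectrum_of_asympStableCaputo [CompleteSpace H] {α : ℝ} {A : H →L[ℂ] H}
    (h : AsympStableCaputo α A) {z : ℂ} (hz : 1 < ‖z‖) : symbol α z ∉ spectrum ℂ A := by
  obtain ⟨ρ, hρ, B, hTB, -, hB⟩ := exists_invertibleWithCausalInverse α A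
  have hz0 : z ≠ 0 := norm_pos_iff.1 (zero_lt_one.trans hz)
  have h1z : (1 : ℂ) - z⁻¹ ≠ 0 := fun h0 => by
    have := norm_inv_lt_one hz
    rw [← sub_eq_zero.1 h0, norm_one] at this
    exact lt_irrefl _ this
  refine symbol_notMem_spectrum α A hz (mul_ne_zero
    (onePlusPow_neg_ne_zero α (norm_inv_lt_one hz)) (mul_ne_zero hz0 (inv_ne_zero h1z)))
    fun x => ?_
  set v : WeightedL2 H ρ := fracDiff α (stepSeq hρ (-1) x) with hv
  have hTu : eqOperator α A (B v) = v := congrArg (fun T => T v) hTB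
  have hstep : Function.support (stepSeq hρ (-1) x : ℤ → H) ⊆ Set.Ici (-1) := fun k hk => by
    by_contra hk1
    exact hk (if_neg hk1)
  have hvs : SupportedGE (-1) v := fun k hk => by
    by_contra hk1
    refine hk ((Submodule.mem_bot ℂ).1 ?_)
    refine fracDiff_apply_mem hρ α (M := ⊥) isClosed_singleton k fun j hj => ?_
    refine (Submodule.mem_bot ℂ).2 (if_neg fun hj1 => hk1 (hj1.trans hj))
  have hsupp : SupportedGE 0 (B v) := supportedGE_zero_of_eqOperator hρ hB hTB hvs
  refine ⟨ρ, B v, hρ, hsupp, ?_, ?_, ?_⟩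
  · exact summable_transform_of_tendsto_zero hsupp
      (h ρ hρ x _ (eqOperator_eq_iff.1 hTu) hsupp) hz
  · intro n
    rw [hTu]
    refine fracDiff_apply_mem hρ α (Submodule.closed_of_finiteDimensional _) n fun k _ => ?_
    rw [stepSeq_apply]
    split_ifs
    · exact Submodule.mem_span_singleton_self x
    · exact Submodule.zero_mem _
  · rw [hTu, mul_smul, ← (hasSum_transform_stepSeq hρ x hz).tsum_eq]
    refine hasSum_transform_fracDiff hρ α _ hz ?_
    refine summable_transform_of_le (K := ‖x‖) (r := 1) one_pos hz hstep fun n => ?_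
    rw [stepSeq_apply, one_zpow, mul_one]
    split_ifs
    · exact le_rfl
    · simp

theorem forall_spectrum_inter_circle_eq_empty_iff {α : ℝ} {A : H →L[ℂ] H} :
    (∀ μ : ℝ, 1 < μ → spectrum ℂ A ∩ symbol α '' circle μ = ∅) ↔
      ∀ z : ℂ, 1 < ‖z‖ → symbol α z ∉ spectrum ℂ A := by
  constructor
  · intro h z hz hmem
    have : symbol α z ∈ spectrum ℂ A ∩ symbol α '' circle ‖z‖ :=
      ⟨hmem, z, by simp [circle], rfl⟩
    rw [h _ hz] at this
    exact this
  · intro h μ hμ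
    refine Set.eq_empty_iff_forall_notMem.2 ?_
    rintro _ ⟨hmem, z, hz, rfl⟩
    have : ‖z‖ = μ := by simpa [circle] using hz
    exact h z (this ▸ hμ) hmem

theorem forall_invertible_iff_forall_notMem_spectrum [CompleteSpace H] {α : ℝ} {A : H →L[ℂ] H} :
    (∀ μ : Set.Ioi (0 : ℝ), 1 < (μ : ℝ) → InvertibleWithCausalInverse
      (eqOperator α A : WeightedL2 H μ →L[ℂ] WeightedL2 H μ)) ↔
      ∀ z : ℂ, 1 < ‖z‖ → symbol α z ∉ spectrum ℂ A := by
  constructor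
  · intro h z hz
    obtain ⟨μ, hμ, hμz⟩ := exists_between hz
    exact notMem_spectrum_of_invertible (ρ := ⟨μ, one_pos.trans hμ⟩) hμ (h _ hμ) hμz
  · intro h μ hμ
    exact invertibleWithCausalInverse_of_isUnit α A le_rfl
      (fun w hw => isUnit_pencil_of_notMem_spectrum h hw) (inv_lt_one_of_one_lt₀ hμ)

end Stability

end FracDiff

theorem mainTheorem3 {H : Type*} [NormedAddCommGroup H] [InnerProductSpace ℂ H] [CompleteSpace H]
    [TopologicalSpace.SeparableSpace H] (α : ℝ) (hα0 : 0 < α) (hα1 : α < 1) (A : H →L[ℂ] H) :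
    (FracDiff.AsympStableRL α A ∨ FracDiff.AsympStableCaputo α A →
      (∀ μ : Set.Ioi (0 : ℝ), 1 < (μ : ℝ) →
        FracDiff.InvertibleWithCausalInverse
          (FracDiff.eqOperator α A : FracDiff.WeightedL2 H μ →L[ℂ] FracDiff.WeightedL2 H μ)) ∧
      (∀ μ : ℝ, 1 < μ → spectrum ℂ A ∩ FracDiff.symbol α '' FracDiff.circle μ = ∅)) ∧
    ((∀ μ : Set.Ioi (0 : ℝ), 1 < (μ : ℝ) →
        FracDiff.InvertibleWithCausalInverse
          (FracDiff.eqOperator α A : FracDiff.WeightedL2 H μ →L[ℂ] FracDiff.WeightedL2 H μ)) ↔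
      (∀ μ : ℝ, 1 < μ → spectrum ℂ A ∩ FracDiff.symbol α '' FracDiff.circle μ = ∅)) := by
  rw [FracDiff.forall_invertible_iff_forall_notMem_spectrum,
    FracDiff.forall_spectrum_inter_circle_eq_empty_iff, and_self_iff]
  refine ⟨fun h z hz => ?_, Iff.rfl⟩
  rcases h with h | h
  · exact FracDiff.notMem_spectrum_of_asympStableRL h hz
  · exact FracDiff.notMem_spectrum_of_asympStableCaputo h hz
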